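/- Let $1\le r\le d_A\le d_B$ be integers, and let $\{|i\rangle_A\}_{i=0}^{d_A-1}$ and $\{|i\rangle_B\}_{i=0}^{d_B-1}$ be the standard orthonormal bases of $\mathcal H_A=\mathbb C^{d_A}$ and $\mathcal H_B=\mathbb C^{d_B}$. The Schmidt number of a unit vector $|\psi\rangle\in\mathcal H_A\otimes\mathcal H_B$ is the rank of $\mathrm{Tr}_B(|\psi\rangle\langle\psi|)$. The Schmidt number $\mathrm{SN}(\rho)$ of a density operator $\rho$ on $\mathcal H_A\otimes\mathcal H_B$ is the smallest integer $k$ such that $\rho$ is a convex combination of operators $|\psi\rangle\langle\psi|$, where each $|\psi\rangle$ is a unit vector with Schmidt number at most $k$. Let $$|+_r\rangle=\frac1{\sqrt r}\sum_{i=0}^{r-1}|i\rangle_A\otimes|i\rangle_B,\qquad \rho_{\varepsilon,r}=(1-\varepsilon)\,|+_r\rangle\langle+_r|+\varepsilon\,\frac{I}{d_Ad_B},\qquad 0\le\varepsilon<1,$$ and let $u=\dfrac{\varepsilon}{(1-\varepsilon)d_Ad_B}$. Then $$\left\lceil\frac{(1+u)r}{1+d_B\,r\,u}\right\rceil\le \mathrm{SN}(\rho_{\varepsilon,r})\le\left\lceil\frac{(1+u)r}{1+r^2u}\right\rceil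 .$$ If moreover $r\le\sqrt{d_A}$ and $\varepsilon<1/2$, then $\mathrm{SN}(\rho_{\varepsilon,r})=r$. -/

import Mathlib

open scoped Matrix ComplexOrder

noncomputable section

/-- Operators on `ℂ^dA ⊗ ℂ^dB`, as matrices in the product basis `|i⟩ ⊗ |j⟩`. -/
abbrev BipartiteOp (dA dB : ℕ) : Type :=
  Matrix (Fin dA × Fin dB) (Fin dA × Fin dB) ℂ

/-- Vectors of `ℂ^dA ⊗ ℂ^dB`, through their coordinates in the product basis. -/
abbrev BipartiteVec (dA dB : ℕ) : Type := Fin dA × Fin dB → ℂ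

/-- The set of density operators: positive semidefinite operators with unit trace. -/
def densityOperators (dA dB : ℕ) : Set (BipartiteOp dA dB) :=
  {ρ | ρ.PosSemidef ∧ ρ.trace = 1}

/-- Pure states: vectors of unit (Hermitian) norm. -/
def IsPureState {dA dB : ℕ} (ψ : BipartiteVec dA dB) : Prop :=
  star ψ ⬝ᵥ ψ = 1

/-- The operator `|ψ⟩⟨ψ|`. -/
def ketBra {dA dB : ℕ} (ψ : BipartiteVec dA dB) : BipartiteOp dA dB :=
  Matrix.vecMulVec ψ (star ψ)

/-- The partial trace over the second factor. -/
def partialTraceB {dA dB : ℕ} (X : BipartiteOp dA dB) : Matrix (Fin dA) (Fin dA) ℂ :=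
  Matrix.of fun i i' => ∑ j, X (i, j) (i', j)

/-- The Schmidt number of a pure state: the rank of its reduced density operator. -/
def pureSchmidtNumber {dA dB : ℕ} (ψ : BipartiteVec dA dB) : ℕ :=
  (partialTraceB (ketBra ψ)).rank

/-- The density operators that are convex combinations of pure states with
Schmidt number at most `k`. -/
def schmidtClass (dA dB k : ℕ) : Set (BipartiteOp dA dB) :=
  {ρ | ρ ∈ densityOperators dA dB ∧
    ρ ∈ convexHull ℝ
      {σ | ∃ ψ : BipartiteVec dA dB, IsPureState ψ ∧ pureSchmidtNumber ψ ≤ k ∧ σ = ketBra ψ}}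

/-- The Schmidt number of a density operator: the least `k` such that it lies in
`schmidtClass dA dB k`. -/
def schmidtNumber {dA dB : ℕ} (ρ : BipartiteOp dA dB) : ℕ :=
  sInf {k | ρ ∈ schmidtClass dA dB k}

/-- The maximally entangled state `|+_r⟩ = r^(-1/2) ∑_{i<r} |i⟩ ⊗ |i⟩`. -/
def plusState (dA dB r : ℕ) : BipartiteVec dA dB :=
  fun p => if (p.1 : ℕ) = (p.2 : ℕ) ∧ (p.1 : ℕ) < r then ((1 / √(r : ℝ) : ℝ) : ℂ) else 0

/-- The noisy state `(1 - ε) |+_r⟩⟨+_r| + ε I / (dA dB)`. -/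
def noisyPlusState (dA dB r : ℕ) (ε : ℝ) : BipartiteOp dA dB :=
  (1 - ε) • ketBra (plusState dA dB r) + (ε / ((dA : ℝ) * (dB : ℝ))) • (1 : BipartiteOp dA dB)

end

/-! Vectors are identified with coefficient matrices, so that the Schmidt number of a pure state is
the rank of its matrix.

Upper bound. On `ℂ^r ⊗ ℂ^r`, average the vector of a rank-`k` projection over all `U ⊗ Ū`. The rank
is unchanged, and the average is invariant, hence `a Φ + b 1` with `Φ = |Ω⟩⟨Ω|`, `Ω = ∑ |ii⟩`
(`eq_smul_add_smul_of_tensorConj_invariant`). Its trace `k` and overlap `k²` with `Ω` determine `a`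
and `b`. Embedded and rescaled to the right multiple of `|+_r⟩⟨+_r|`, it differs from the noisy
state by a diagonal operator, which is nonnegative once `(1+u)r/(1+r²u) ≤ k`. Haar measure is
avoided: the point of least Frobenius norm in the compact convex hull of the orbit is unique, hence
invariant.

Lower bound. `|tr N|² ≤ rank N · ‖N‖²` makes `schmidtWitness` nonnegative on pure states of Schmidt
number at most `k`, hence on their mixtures; its value on the noisy state gives the bound. When `r²
≤ dA` and `ε < 1/2` this bound exceeds `r - 1`. -/

open scoped Kronecker

/-! ### Compactness and fixed points of unitary conjugations -/

/-- In a finite-dimensional space the convex hull of a compact set is compact. -/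
theorem IsCompact.convexHull_of_finiteDimensional {E : Type*} [AddCommGroup E] [Module ℝ E]
    [FiniteDimensional ℝ E] [TopologicalSpace E] [ContinuousAdd E] [ContinuousSMul ℝ E]
    {s : Set E} (hs : IsCompact s) : IsCompact (convexHull ℝ s) := by
  -- By Carathéodory `finrank + 1` points suffice, so the hull is a finite union of continuous
  -- images of the compacts `stdSimplex × s^n`.
  have key : convexHull ℝ s = ⋃ n ∈ Set.Iic (Module.finrank ℝ E + 1),
      (fun p : (Fin n → ℝ) × (Fin n → E) => ∑ i, p.1 i • p.2 i) ''
        (stdSimplex ℝ (Fin n) ×ˢ Set.univ.pi fun _ => s) := by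
    apply Set.Subset.antisymm
    · intro x hx
      obtain ⟨ι, _, z, w, hz, hind, hpos, hsum, rfl⟩ := eq_pos_convex_span_of_mem_convexHull hx
      have hcard : Fintype.card ι ≤ Module.finrank ℝ E + 1 :=
        hind.card_le_finrank_succ.trans
          (Nat.succ_le_succ (Submodule.finrank_le _))
      let e := (Fintype.equivFin ι).symm
      refine Set.mem_biUnion (Set.mem_Iic.2 hcard) ⟨(w ∘ e, z ∘ e), ⟨⟨?_, ?_⟩, ?_⟩, ?_⟩
      · exact fun i => (hpos _).le
      · rw [← hsum]; exact e.sum_comp w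
      · exact fun i _ => hz ⟨_, rfl⟩
      · exact e.sum_comp fun i => w i • z i
    · intro x hx
      simp only [Set.mem_iUnion] at hx
      obtain ⟨n, -, ⟨w, z⟩, ⟨⟨hw, hw1⟩, hz⟩, rfl⟩ := hx
      exact (convex_convexHull ℝ s).sum_mem (fun i _ => hw i) hw1
        fun i _ => subset_convexHull ℝ s (hz i (Set.mem_univ i))
  rw [key]
  refine (Set.finite_Iic _).isCompact_biUnion fun n _ => ?_
  refine ((isCompact_stdSimplex ℝ (Fin n)).prod (isCompact_univ_pi fun _ => hs)).image ?_
  fun_prop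

/-- The unitary group of matrices is compact. -/
theorem Matrix.isCompact_unitaryGroup (n : Type*) [Fintype n] [DecidableEq n] :
    IsCompact (Matrix.unitaryGroup n ℂ : Set (Matrix n n ℂ)) := by
  have hK : IsCompact (Set.univ.pi fun _ : n => Set.univ.pi fun _ : n =>
      Metric.closedBall (0 : ℂ) 1) :=
    isCompact_univ_pi fun _ => isCompact_univ_pi fun _ => isCompact_closedBall _ _
  refine IsCompact.of_isClosed_subset (t := (Matrix.unitaryGroup n ℂ : Set (Matrix n n ℂ))) hK ?_ ?_
  · have : (Matrix.unitaryGroup n ℂ : Set (Matrix n n ℂ)) = {U | U * star U = 1} := by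
      ext U; exact Matrix.mem_unitaryGroup_iff
    rw [this]
    exact isClosed_eq (by fun_prop) continuous_const
  · intro U hU i _ j _
    simpa using entry_norm_bound_of_unitary hU i j

/-- A compact convex set of matrices that is stable under conjugation by a family of unitaries
contains a matrix that is fixed by all of them: the one of least Frobenius norm. -/
theorem Matrix.exists_fixed_of_isCompact_convex {m : Type*} [Fintype m] [DecidableEq m]
    {K : Set (Matrix m m ℂ)} (hK : IsCompact K) (hconv : Convex ℝ K) (hne : K.Nonempty)
    (T : Set (Matrix m m ℂ)) (hT : ∀ V ∈ T, Vᴴ * V = 1)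
    (hstab : ∀ V ∈ T, ∀ X ∈ K, V * X * Vᴴ ∈ K) :
    ∃ X ∈ K, ∀ V ∈ T, V * X * Vᴴ = X := by
  let f : Matrix m m ℂ → ℝ := fun X => (Xᴴ * X).trace.re
  have hf : Continuous f := by
    have : Continuous fun X : Matrix m m ℂ => (Xᴴ * X).trace := by fun_prop
    exact Complex.continuous_re.comp this
  have hf0 : ∀ X, 0 ≤ f X := fun X =>
    (Complex.le_def.1 (Matrix.posSemidef_conjTranspose_mul_self X).trace_nonneg).1
  have hfz : ∀ X, f X ≤ 0 → X = 0 := fun X h => by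
    have h0 := (Matrix.posSemidef_conjTranspose_mul_self X).trace_nonneg
    rw [← Matrix.trace_conjTranspose_mul_self_eq_zero_iff]
    exact Complex.ext (le_antisymm h (hf0 X)) (Complex.le_def.1 h0).2.symm
  obtain ⟨X, hX, hmin⟩ := hK.exists_isMinOn hne hf.continuousOn
  refine ⟨X, hX, fun V hV => ?_⟩
  set Y := V * X * Vᴴ with hY
  have hYK : Y ∈ K := hstab V hV X hX
  have hfY : f Y = f X := by
    simp only [f, hY]
    congr 1
    rw [show (V * X * Vᴴ)ᴴ * (V * X * Vᴴ) = V * (Xᴴ * (Vᴴ * V) * X * Vᴴ) by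
      simp [Matrix.mul_assoc], hT V hV, Matrix.mul_one, Matrix.trace_mul_comm, Matrix.mul_assoc,
      hT V hV, Matrix.mul_one]
  have hmid : (1 / 2 : ℝ) • X + (1 / 2 : ℝ) • Y ∈ K :=
    hconv hX hYK (by norm_num) (by norm_num) (by norm_num)
  have hle : f X ≤ f ((1 / 2 : ℝ) • X + (1 / 2 : ℝ) • Y) := hmin hmid
  -- Parallelogram law: since `f Y = f X`, a nonzero `Y - X` would make the midpoint strictly
  -- shorter than the minimizer.
  have hpar : f ((1 / 2 : ℝ) • X + (1 / 2 : ℝ) • Y) = (f X + f Y) / 2 - f (Y - X) / 4 := by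
    simp only [f, Matrix.conjTranspose_add, Matrix.conjTranspose_smul, Matrix.add_mul,
      Matrix.mul_add, Matrix.conjTranspose_sub, Matrix.sub_mul, Matrix.mul_sub, Matrix.trace_add,
      Matrix.trace_sub, Matrix.smul_mul, Matrix.mul_smul, Matrix.trace_smul, Complex.add_re,
      Complex.sub_re, Complex.smul_re, star_trivial, smul_eq_mul]
    ring
  rw [← sub_eq_zero]
  apply hfz
  linarith

/-! ### Trace, rank and Frobenius norm -/

/-- The trace of a matrix is controlled by its rank and its Frobenius norm. -/
theorem Matrix.norm_trace_sq_le_rank_mul {n : Type*} [Fintype n] [DecidableEq n]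
    (N : Matrix n n ℂ) : ‖N.trace‖ ^ 2 ≤ N.rank * ∑ i, ∑ j, ‖N i j‖ ^ 2 := by
  let W : Submodule ℂ (EuclideanSpace ℂ n) := LinearMap.range (Matrix.toEuclideanLin N)
  have hW : Module.finrank ℂ W = N.rank := by
    rw [Matrix.rank_eq_finrank_range_toLin N (EuclideanSpace.basisFun n ℂ).toBasis
      (EuclideanSpace.basisFun n ℂ).toBasis]
    rfl
  let e := stdOrthonormalBasis ℂ W
  let c : n → EuclideanSpace ℂ n := fun j => WithLp.toLp 2 fun i => N i j
  have hc : ∀ j, c j ∈ W := fun j => ⟨EuclideanSpace.single j 1, by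
    ext i; simp [c, Matrix.toLpLin_apply]⟩
  -- Each column is expanded in an orthonormal basis of the range. Cauchy–Schwarz over the pairs
  -- `(j, a)` then gives the Frobenius norm from the coefficients and the rank from the unit vectors
  -- `e a`.
  have hexp : ∀ j, N j j = ∑ a, inner ℂ (e a) ⟨c j, hc j⟩ * (e a : EuclideanSpace ℂ n) j := by
    intro j
    have := congrArg (fun w : W => (w : EuclideanSpace ℂ n) j) (e.sum_repr' ⟨c j, hc j⟩)
    simpa [c] using this.symm
  have hnorm : ∀ j, ∑ a, ‖inner ℂ (e a) (⟨c j, hc j⟩ : W)‖ ^ 2 = ∑ i, ‖N i j‖ ^ 2 := by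
    intro j
    rw [e.sum_sq_norm_inner_right, Submodule.coe_norm, EuclideanSpace.norm_sq_eq]
  have hone : ∀ a, ∑ j, ‖(e a : EuclideanSpace ℂ n) j‖ ^ 2 = 1 := by
    intro a
    rw [← EuclideanSpace.norm_sq_eq, ← Submodule.coe_norm, e.norm_eq_one, one_pow]
  have htr : ‖N.trace‖ ≤ ∑ p : n × Fin (Module.finrank ℂ W),
      ‖inner ℂ (e p.2) (⟨c p.1, hc p.1⟩ : W)‖ * ‖(e p.2 : EuclideanSpace ℂ n) p.1‖ := by
    rw [Fintype.sum_prod_type, Matrix.trace]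
    refine (norm_sum_le _ _).trans (Finset.sum_le_sum fun j _ => ?_)
    rw [Matrix.diag_apply, hexp j]
    exact (norm_sum_le _ _).trans (Finset.sum_le_sum fun a _ => (norm_mul _ _).le)
  calc ‖N.trace‖ ^ 2 ≤ _ := pow_le_pow_left₀ (norm_nonneg _) htr 2
    _ ≤ _ := Finset.sum_mul_sq_le_sq_mul_sq _ _ _
    _ = N.rank * ∑ i, ∑ j, ‖N i j‖ ^ 2 := by
      rw [Fintype.sum_prod_type, Fintype.sum_prod_type_right]
      simp only [hnorm, hone]
      rw [Finset.sum_comm, mul_comm]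
      simp [hW]

/-! ### Operators invariant under `U ⊗ Ū` -/

namespace Matrix

variable {n : Type*}

/-- The vector with coordinates `P i j` in the product basis. -/
def rowVec {m n : Type*} (P : Matrix m n ℂ) : m × n → ℂ := fun p => P p.1 p.2

/-- The operator `U ⊗ Ū`. -/
def tensorConj (U : Matrix n n ℂ) : Matrix (n × n) (n × n) ℂ := U ⊗ₖ U.map star

theorem conj_vecMulVec {m l : Type*} [Fintype m] (V : Matrix l m ℂ) (ψ : m → ℂ) :
    V * vecMulVec ψ (star ψ) * Vᴴ = vecMulVec (V *ᵥ ψ) (star (V *ᵥ ψ)) := by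
  rw [mul_vecMulVec, vecMulVec_mul, star_mulVec]

/-- This turns the action on vectors into conjugation of coefficient matrices, which preserves rank
and fixes the identity, that is `Ω`. -/
theorem tensorConj_mulVec_rowVec [Fintype n] (U P : Matrix n n ℂ) :
    tensorConj U *ᵥ rowVec P = rowVec (U * P * Uᴴ) := by
  ext ⟨i, j⟩
  simp only [tensorConj, rowVec, mulVec, dotProduct, Fintype.sum_prod_type, kroneckerMap_apply,
    map_apply, mul_apply, conjTranspose_apply, Finset.sum_mul]
  rw [Finset.sum_comm]
  exact Finset.sum_congr rfl fun a _ => Finset.sum_congr rfl fun b _ => by ring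

/-- The operator `|Ω⟩⟨Ω|` with `Ω = ∑ i, |i⟩ ⊗ |i⟩`. -/
def maxEntangled (n : Type*) [DecidableEq n] : Matrix (n × n) (n × n) ℂ :=
  vecMulVec (rowVec (1 : Matrix n n ℂ)) (star (rowVec (1 : Matrix n n ℂ)))

variable [Fintype n] [DecidableEq n]

theorem conjTranspose_tensorConj_mul_self {U : Matrix n n ℂ} (hU : U ∈ unitaryGroup n ℂ) :
    (tensorConj U)ᴴ * tensorConj U = 1 := by
  have h : Uᴴ * U = 1 := mem_unitaryGroup_iff'.1 hU
  have h' : (U.map star)ᴴ * U.map star = 1 := by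
    have := congrArg (fun M : Matrix n n ℂ => M.map (starRingEnd ℂ)) h
    simp only [Matrix.map_mul] at this
    rw [Matrix.map_one _ (map_zero _) (map_one _)] at this
    rwa [show (U.map star)ᴴ = Uᴴ.map (starRingEnd ℂ) from rfl]
  rw [tensorConj, conjTranspose_kronecker, ← mul_kronecker_mul, h, h', one_kronecker_one]

/-- Invariance under diagonal phases leaves only the entries of `Φ` and of the diagonal. -/
theorem apply_eq_zero_of_tensorConj_invariant {X : Matrix (n × n) (n × n) ℂ}
    (hX : ∀ U ∈ unitaryGroup n ℂ, tensorConj U * X * (tensorConj U)ᴴ = X) (i j i' j' : n)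
    (h₁ : ¬(i = j ∧ i' = j')) (h₂ : ¬(i = i' ∧ j = j')) : X (i, j) (i', j') = 0 := by
  -- A phase `I` at the single coordinate `a` multiplies the entry by a power of `I`; each case
  -- below picks `a` so that this power is not `1`. A sign `-1` would fail when `i = j'`, where the
  -- phase enters squared.
  have key : ∀ a : n, (Function.update (1 : n → ℂ) a Complex.I i *
      star (Function.update (1 : n → ℂ) a Complex.I j)) * X (i, j) (i', j') *
      star (Function.update (1 : n → ℂ) a Complex.I i' *
      star (Function.update (1 : n → ℂ) a Complex.I j')) = X (i, j) (i', j') := by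
    intro a
    set d := Function.update (1 : n → ℂ) a Complex.I with hd
    have hd1 : ∀ x, d x * star (d x) = 1 := by
      intro x
      by_cases hx : x = a
      · subst hx; simp [hd]
      · simp [hd, hx]
    have hU : diagonal d ∈ unitaryGroup n ℂ := by
      rw [mem_unitaryGroup_iff, star_eq_conjTranspose, diagonal_conjTranspose,
        diagonal_mul_diagonal, ← diagonal_one]
      congr 1
      ext x; exact hd1 x
    have h := congrFun (congrFun (hX _ hU) (i, j)) (i', j')
    have hV : tensorConj (diagonal d) = diagonal fun p : n × n => d p.1 * star (d p.2) := by
      rw [tensorConj, diagonal_map (star_zero ℂ), diagonal_kronecker_diagonal]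
    rw [hV, diagonal_conjTranspose, mul_diagonal, diagonal_mul] at h
    simpa using h
  have hI : Complex.I ≠ 1 := fun h => by simpa using congrArg Complex.im h
  have hl : ∀ {x : ℂ}, Complex.I * x = x → x = 0 := fun {x} h =>
    (mul_eq_zero.1 (show (Complex.I - 1) * x = 0 by rw [sub_mul, h, one_mul, sub_self])).resolve_left
      (sub_ne_zero.2 hI)
  have hr : ∀ {x : ℂ}, x * Complex.I = x → x = 0 := fun {x} h => hl (by rwa [mul_comm])
  have hlr : ∀ {x : ℂ}, Complex.I * x * Complex.I = x → x = 0 := fun {x} h => by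
    linear_combination (-1 / 2 : ℂ) * h + (x / 2) * Complex.I_mul_I
  by_cases hij : i = j
  · subst hij
    have hne : i' ≠ j' := fun h => h₁ ⟨rfl, h⟩
    have := key j'
    simp only [Function.update_apply, hne, if_true, if_false] at this
    split_ifs at this <;> exact hr (by simpa using this)
  · by_cases hii : i = i'
    · subst hii
      have hne : j ≠ j' := fun h => h₂ ⟨rfl, h⟩
      have := key j'
      simp only [Function.update_apply, hne, if_true, if_false] at this
      split_ifs at this <;>
        first | exact hr (by simpa using this) | exact hl (by simpa using this)
    · have := key i
      simp only [Function.update_apply, Ne.symm hij, Ne.symm hii, if_true, if_false] at this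
      split_ifs at this <;>
        first | exact hl (by simpa using this) | exact hlr (by simpa using this)

theorem apply_perm_of_tensorConj_invariant {X : Matrix (n × n) (n × n) ℂ}
    (hX : ∀ U ∈ unitaryGroup n ℂ, tensorConj U * X * (tensorConj U)ᴴ = X) (σ : Equiv.Perm n)
    (i j i' j' : n) : X (σ i, σ j) (σ i', σ j') = X (i, j) (i', j') := by
  let U : Matrix n n ℂ := (1 : Matrix n n ℂ).submatrix σ id
  have hU : U ∈ unitaryGroup n ℂ := by
    rw [mem_unitaryGroup_iff, star_eq_conjTranspose]
    ext i j
    simp [U, mul_apply, one_apply]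
  have hV : tensorConj U = (1 : Matrix (n × n) (n × n) ℂ).submatrix (Equiv.prodCongr σ σ) id := by
    ext ⟨a, b⟩ ⟨c, d⟩
    by_cases h : σ a = c <;> by_cases h' : σ b = d <;> simp [tensorConj, U, one_apply, h, h']
  have h := congrFun (congrFun (hX U hU) (i, j)) (i', j')
  rw [hV] at h
  simpa [conjTranspose_submatrix, mul_apply, one_apply] using h

/-- A unitary all of whose entries are nonzero. -/
theorem exists_unitary_forall_ne_zero [Nonempty n] :
    ∃ U ∈ unitaryGroup n ℂ, ∀ i j, U i j ≠ 0 := by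
  have hr : (Fintype.card n : ℂ) ≠ 0 := by simp
  have hr' : (Fintype.card n : ℝ) ≠ 0 := by simp
  -- With `J` the all-ones matrix, `1 + ((I - 1)/r) J` has eigenvalue `I` on the constant vector and
  -- `1` on its complement. Every entry has imaginary part `1/r`.
  refine ⟨of fun i j => (if i = j then 1 else 0) + (Complex.I - 1) / Fintype.card n, ?_, ?_⟩
  · rw [mem_unitaryGroup_iff, star_eq_conjTranspose]
    ext i j
    simp only [mul_apply, conjTranspose_apply, of_apply, star_add, apply_ite star, star_one,
      star_zero, add_mul, mul_add, Finset.sum_add_distrib, one_apply]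
    simp
    field_simp
    split_ifs <;> simp_all <;> ring_nf <;> simp
  · intro i j h
    have h2 := congrArg Complex.im h
    simp only [of_apply, Complex.add_im, Complex.div_natCast_im, Complex.sub_im, Complex.I_im,
      Complex.one_im] at h2
    split_ifs at h2 <;> simp at h2

/-- Operators commuting with all `U ⊗ Ū` are combinations of `Φ` and the identity. -/
theorem eq_smul_add_smul_of_tensorConj_invariant [Nontrivial n] {X : Matrix (n × n) (n × n) ℂ}
    (hX : ∀ U ∈ unitaryGroup n ℂ, tensorConj U * X * (tensorConj U)ᴴ = X) :
    ∃ a b : ℂ, X = a • maxEntangled n + b • 1 := by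
  obtain ⟨i₀, j₀, hij₀⟩ := exists_pair_ne n
  let D : Matrix (n × n) (n × n) ℂ := diagonal fun p => if p.1 = p.2 then 1 else 0
  set a := X (i₀, i₀) (j₀, j₀)
  set b := X (i₀, j₀) (i₀, j₀)
  set t := X (i₀, i₀) (i₀, i₀) - a - b with ht
  have htrans : ∀ i j, i ≠ j → ∃ σ : Equiv.Perm n, σ i₀ = i ∧ σ j₀ = j := fun i j hij =>
    (MulAction.is_two_pretransitive_iff (G := Equiv.Perm n)).1
      (Equiv.Perm.isMultiplyPretransitive n 2) hij₀ hij
  -- Phases kill all other entries, and two-transitivity of the permutations leaves three constants.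
  -- `D` projects onto the span of the `|ii⟩`, and `t` must be shown to vanish.
  have hsplit : X = a • maxEntangled n + b • 1 + t • D := by
    ext ⟨i, j⟩ ⟨i', j'⟩
    by_cases h₁ : i = j ∧ i' = j'
    · obtain ⟨rfl, rfl⟩ := h₁
      by_cases h : i = i'
      · subst h
        rw [← Equiv.swap_apply_left i₀ i, apply_perm_of_tensorConj_invariant hX]
        simp [maxEntangled, D, rowVec, vecMulVec_apply, ht]
      · obtain ⟨σ, rfl, rfl⟩ := htrans i i' h
        rw [apply_perm_of_tensorConj_invariant hX]
        simp [maxEntangled, D, rowVec, vecMulVec_apply, hij₀, a]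
    · by_cases h₂ : i = i' ∧ j = j'
      · obtain ⟨rfl, rfl⟩ := h₂
        have h : i ≠ j := fun h => h₁ ⟨h, h⟩
        obtain ⟨σ, rfl, rfl⟩ := htrans i j h
        rw [apply_perm_of_tensorConj_invariant hX]
        simp [maxEntangled, D, rowVec, vecMulVec_apply, hij₀, b]
      · rw [apply_eq_zero_of_tensorConj_invariant hX i j i' j' h₁ h₂]
        have h₃ : (i, j) ≠ (i', j') := by simpa [Prod.ext_iff] using h₂
        simp only [maxEntangled, D, rowVec, add_apply, smul_apply, vecMulVec_apply, one_apply, diagonal_apply,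
          h₃, Pi.star_apply]
        by_cases hij : i = j
        · have : i' ≠ j' := fun h => h₁ ⟨hij, h⟩
          simp [this]
        · simp [hij]
  obtain ⟨U, hU, hne⟩ := exists_unitary_forall_ne_zero (n := n)
  have hV := conjTranspose_tensorConj_mul_self hU
  have hΦ : tensorConj U * maxEntangled n * (tensorConj U)ᴴ = maxEntangled n := by
    have : U * Uᴴ = 1 := mem_unitaryGroup_iff.1 hU
    rw [maxEntangled, conj_vecMulVec, tensorConj_mulVec_rowVec, Matrix.mul_one, this]
  have htD : t • (tensorConj U * D * (tensorConj U)ᴴ) = t • D := by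
    have h := hX U hU
    rw [hsplit] at h
    simpa [Matrix.mul_add, Matrix.add_mul, hΦ, mul_eq_one_comm.1 hV] using h
  have hentry := congrFun (congrFun htD (i₀, i₀)) (j₀, j₀)
  -- This entry vanishes for `D` itself, so invariance of `t • D` forces `t = 0`.
  have hpos : (tensorConj U * D * (tensorConj U)ᴴ) (i₀, i₀) (j₀, j₀) ≠ 0 := by
    have : (tensorConj U * D * (tensorConj U)ᴴ) (i₀, i₀) (j₀, j₀) =
        ((∑ l, ‖U i₀ l‖ ^ 2 * ‖U j₀ l‖ ^ 2 : ℝ) : ℂ) := by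
      simp only [D, mul_apply (N := (tensorConj U)ᴴ), mul_diagonal, Fintype.sum_prod_type]
      simp only [tensorConj, kroneckerMap_apply, map_apply, conjTranspose_apply, mul_ite, mul_one,
        mul_zero, ite_mul, zero_mul, Finset.sum_ite_eq, Finset.mem_univ, if_true]
      push_cast
      refine Finset.sum_congr rfl fun l _ => ?_
      rw [← Complex.mul_conj', ← Complex.mul_conj']
      simp only [RCLike.star_def, map_mul, Complex.conj_conj]
      ring
    rw [this, Ne, Complex.ofReal_eq_zero]
    exact (Finset.sum_pos (fun l _ => mul_pos (pow_pos (norm_pos_iff.2 (hne _ _)) 2)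
      (pow_pos (norm_pos_iff.2 (hne _ _)) 2)) Finset.univ_nonempty).ne'
  have ht0 : t = 0 := by
    simp only [smul_apply, smul_eq_mul, D, diagonal_apply, Prod.mk.injEq, hij₀, false_and, if_false,
      mul_zero, mul_eq_zero] at hentry
    exact hentry.resolve_right hpos
  exact ⟨a, b, by rw [hsplit, ht0, zero_smul, add_zero]⟩

end Matrix

/-! ### Isotropic operators as averages of rank-`k` projections -/

theorem LinearMap.eq_of_mem_convexHull {E F : Type*} [AddCommGroup E] [Module ℝ E]
    [AddCommGroup F] [Module ℝ F] (f : E →ₗ[ℝ] F) {s : Set E} {c : F} (h : ∀ x ∈ s, f x = c)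
    {x : E} (hx : x ∈ convexHull ℝ s) : f x = c :=
  convexHull_min (t := f ⁻¹' {c}) h ((convex_singleton c).linear_preimage f) hx

namespace Matrix

variable {n : Type*} [Fintype n]

/-- The functional `X ↦ ⟨Ω|X|Ω⟩` with `Ω = ∑ i, |i⟩ ⊗ |i⟩`. -/
def overlapMaxEntangled (n : Type*) [Fintype n] : Matrix (n × n) (n × n) ℂ →ₗ[ℝ] ℂ where
  toFun X := ∑ i, ∑ j, X (i, i) (j, j)
  map_add' X Y := by simp [Finset.sum_add_distrib]
  map_smul' c X := by simp [Finset.mul_sum]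

theorem trace_vecMulVec_rowVec (P : Matrix n n ℂ) :
    (vecMulVec (rowVec P) (star (rowVec P))).trace = (P * Pᴴ).trace := by
  simp [trace, vecMulVec_apply, rowVec, mul_apply, Fintype.sum_prod_type]

theorem overlapMaxEntangled_vecMulVec_rowVec (P : Matrix n n ℂ) :
    overlapMaxEntangled n (vecMulVec (rowVec P) (star (rowVec P))) = P.trace * star P.trace := by
  simp [overlapMaxEntangled, trace, vecMulVec_apply, rowVec, Finset.sum_mul_sum]

variable [DecidableEq n]

/-- The orbit of `|D⟩⟨D|` under the unitaries `U ⊗ Ū`. -/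
def conjOrbit (D : Matrix n n ℂ) : Set (Matrix (n × n) (n × n) ℂ) :=
  (fun U : Matrix n n ℂ => vecMulVec (rowVec (U * D * Uᴴ)) (star (rowVec (U * D * Uᴴ)))) ''
    (unitaryGroup n ℂ : Set (Matrix n n ℂ))

theorem isCompact_conjOrbit (D : Matrix n n ℂ) : IsCompact (conjOrbit D) := by
  refine (isCompact_unitaryGroup n).image ?_
  have h : Continuous fun U : Matrix n n ℂ => rowVec (U * D * Uᴴ) := by
    refine continuous_pi fun p => ?_
    have : Continuous fun U : Matrix n n ℂ => U * D * Uᴴ := by fun_prop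
    exact this.matrix_elem p.1 p.2
  exact h.matrix_vecMulVec h.star

theorem tensorConj_conj_mem_conjOrbit {D U : Matrix n n ℂ} (hU : U ∈ unitaryGroup n ℂ)
    {X : Matrix (n × n) (n × n) ℂ} (hX : X ∈ conjOrbit D) :
    tensorConj U * X * (tensorConj U)ᴴ ∈ conjOrbit D := by
  obtain ⟨W, hW, rfl⟩ := hX
  refine ⟨U * W, mul_mem hU hW, ?_⟩
  simp only [conj_vecMulVec, tensorConj_mulVec_rowVec]
  simp only [conjTranspose_mul, Matrix.mul_assoc]

/-- Conjugation `X ↦ V X Vᴴ` as a real-linear map. -/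
def conjLinearMap {m l : Type*} [Fintype m] (V : Matrix l m ℂ) :
    Matrix m m ℂ →ₗ[ℝ] Matrix l l ℂ where
  toFun X := V * X * Vᴴ
  map_add' X Y := by simp [Matrix.mul_add, Matrix.add_mul]
  map_smul' c X := by simp

theorem conjLinearMap_apply {m l : Type*} [Fintype m] (V : Matrix l m ℂ) (X : Matrix m m ℂ) :
    conjLinearMap V X = V * X * Vᴴ := rfl

/-- The isotropic operator of overlap `k / card n` is an average of the vectors of rank-`k`
projections. -/
theorem isotropic_mem_convexHull_conjOrbit [Nontrivial n] (s : Finset n) :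
    ((s.card * (s.card * Fintype.card n - 1) /
        (Fintype.card n * (Fintype.card n ^ 2 - 1)) : ℝ) • maxEntangled n +
      (s.card * (Fintype.card n - s.card) /
        (Fintype.card n * (Fintype.card n ^ 2 - 1)) : ℝ) • (1 : Matrix (n × n) (n × n) ℂ)) ∈
      convexHull ℝ (conjOrbit (diagonal fun i : n => if i ∈ s then (1 : ℂ) else 0)) := by
  set D : Matrix n n ℂ := diagonal fun i : n => if i ∈ s then (1 : ℂ) else 0 with hD
  have hDtr : D.trace = s.card := by simp [hD, trace]
  have hDD : D * Dᴴ = D := by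
    rw [hD, diagonal_conjTranspose, diagonal_mul_diagonal]
    congr 1
    ext i
    by_cases h : i ∈ s <;> simp [h]
  obtain ⟨X, hX, hinv⟩ := exists_fixed_of_isCompact_convex
    (isCompact_conjOrbit D).convexHull_of_finiteDimensional (convex_convexHull ℝ _)
    (Set.Nonempty.convexHull ⟨_, 1, one_mem _, rfl⟩)
    (tensorConj '' (unitaryGroup n ℂ : Set (Matrix n n ℂ)))
    (by rintro _ ⟨U, hU, rfl⟩; exact conjTranspose_tensorConj_mul_self hU)
    (by
      rintro _ ⟨U, hU, rfl⟩ X hX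
      have := Set.mem_image_of_mem (conjLinearMap (tensorConj U)) hX
      rw [LinearMap.image_convexHull] at this
      refine convexHull_mono ?_ this
      rintro _ ⟨Y, hY, rfl⟩
      exact tensorConj_conj_mem_conjOrbit hU hY)
  obtain ⟨a, b, rfl⟩ := eq_smul_add_smul_of_tensorConj_invariant
    fun U hU => hinv _ ⟨U, hU, rfl⟩
  -- Trace and overlap with `Ω` are linear and constant on the orbit, so they keep their values `k`
  -- and `k²` at the fixed point; these are two linear equations for `a` and `b`.
  have h1 := (traceLinearMap (n × n) ℝ ℂ).eq_of_mem_convexHull (c := (s.card : ℂ)) (by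
    rintro _ ⟨U, hU, rfl⟩
    have hU' : Uᴴ * U = 1 := mem_unitaryGroup_iff'.1 hU
    rw [traceLinearMap_apply, trace_vecMulVec_rowVec,
      show U * D * Uᴴ * (U * D * Uᴴ)ᴴ = U * (D * (Uᴴ * U) * Dᴴ * Uᴴ) by
        simp [Matrix.mul_assoc], hU', Matrix.mul_one, hDD, trace_mul_comm, Matrix.mul_assoc, hU',
      Matrix.mul_one, hDtr]) hX
  have h2 := (overlapMaxEntangled n).eq_of_mem_convexHull (c := (s.card : ℂ) ^ 2) (by
    rintro _ ⟨U, hU, rfl⟩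
    have hU' : Uᴴ * U = 1 := mem_unitaryGroup_iff'.1 hU
    rw [overlapMaxEntangled_vecMulVec_rowVec, Matrix.mul_assoc, trace_mul_comm, Matrix.mul_assoc,
      hU', Matrix.mul_one, hDtr]
    simp [sq]) hX
  have h1' : a * Fintype.card n + b * Fintype.card n ^ 2 = s.card := by
    rw [← h1]
    have : (maxEntangled n).trace = Fintype.card n := by
      rw [maxEntangled, trace_vecMulVec_rowVec]
      simp
    simp [this, sq]
  have h2' : a * Fintype.card n ^ 2 + b * Fintype.card n = (s.card : ℂ) ^ 2 := by
    rw [← h2]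
    simp [overlapMaxEntangled, maxEntangled, vecMulVec_apply, rowVec, Finset.sum_add_distrib, sq,
      one_apply]
    ring
  have hr : (1 : ℝ) < Fintype.card n := by exact_mod_cast Fintype.one_lt_card
  have hr0 : (Fintype.card n : ℂ) ≠ 0 := by simp
  have hr1 : (Fintype.card n : ℂ) ^ 2 - 1 ≠ 0 := by
    have : (Fintype.card n : ℝ) ^ 2 - 1 ≠ 0 := by nlinarith
    exact_mod_cast this
  have hne : (Fintype.card n : ℂ) * ((Fintype.card n : ℂ) ^ 2 - 1) ≠ 0 := mul_ne_zero hr0 hr1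
  have ha : a = ((s.card * (s.card * Fintype.card n - 1) /
        (Fintype.card n * (Fintype.card n ^ 2 - 1)) : ℝ) : ℂ) := by
    push_cast
    rw [eq_div_iff hne]
    linear_combination (Fintype.card n : ℂ) * h2' - h1'
  have hb : b = ((s.card * (Fintype.card n - s.card) /
        (Fintype.card n * (Fintype.card n ^ 2 - 1)) : ℝ) : ℂ) := by
    push_cast
    rw [eq_div_iff hne]
    linear_combination (Fintype.card n : ℂ) * h1' - h2'
  rw [ha, hb] at hX
  simpa only [Complex.coe_smul] using hX

end Matrix

/-! ### Schmidt number as rank, and the cone it generates -/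

/-- The matrix of coordinates of a bipartite vector. -/
def coordMatrix {dA dB : ℕ} (ψ : BipartiteVec dA dB) : Matrix (Fin dA) (Fin dB) ℂ :=
  Matrix.of fun i j => ψ (i, j)

theorem coordMatrix_rowVec {dA dB : ℕ} (M : Matrix (Fin dA) (Fin dB) ℂ) :
    coordMatrix (Matrix.rowVec M) = M := rfl

theorem coordMatrix_smul {dA dB : ℕ} (c : ℂ) (ψ : BipartiteVec dA dB) :
    coordMatrix (c • ψ) = c • coordMatrix ψ := rfl

theorem pureSchmidtNumber_eq_rank {dA dB : ℕ} (ψ : BipartiteVec dA dB) :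
    pureSchmidtNumber ψ = (coordMatrix ψ).rank := by
  have : partialTraceB (ketBra ψ) = coordMatrix ψ * (coordMatrix ψ)ᴴ := by
    ext i j
    simp [partialTraceB, ketBra, coordMatrix, Matrix.mul_apply, Matrix.vecMulVec_apply]
  rw [pureSchmidtNumber, this, Matrix.rank_self_mul_conjTranspose]

/-- The projectors on pure states of Schmidt number at most `k`. -/
def pureSchmidtProjectors (dA dB k : ℕ) : Set (BipartiteOp dA dB) :=
  {σ | ∃ ψ : BipartiteVec dA dB, IsPureState ψ ∧ pureSchmidtNumber ψ ≤ k ∧ σ = ketBra ψ}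

/-- The cone generated by the pure states of Schmidt number at most `k`. -/
noncomputable def schmidtCone (dA dB k : ℕ) : PointedCone ℝ (BipartiteOp dA dB) :=
  PointedCone.hull ℝ (pureSchmidtProjectors dA dB k)

theorem trace_ketBra {dA dB : ℕ} (ψ : BipartiteVec dA dB) :
    (ketBra ψ).trace = star ψ ⬝ᵥ ψ := by
  rw [ketBra, Matrix.trace_vecMulVec, dotProduct_comm]

theorem ketBra_smul {dA dB : ℕ} (c : ℂ) (ψ : BipartiteVec dA dB) :
    ketBra (c • ψ) = (‖c‖ ^ 2 : ℝ) • ketBra ψ := by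
  ext p q
  simp only [ketBra, Matrix.vecMulVec_apply, Matrix.smul_apply, Pi.smul_apply, Pi.star_apply,
    star_smul, smul_eq_mul, Complex.real_smul]
  push_cast
  rw [← Complex.mul_conj', RCLike.star_def]
  ring

theorem ketBra_mem_schmidtCone {dA dB k : ℕ} {ψ : BipartiteVec dA dB}
    (h : (coordMatrix ψ).rank ≤ k) : ketBra ψ ∈ schmidtCone dA dB k := by
  by_cases h0 : ψ = 0
  · subst h0
    simp [ketBra]
  set t : ℝ := ∑ p, ‖ψ p‖ ^ 2 with ht
  have hdot : star ψ ⬝ᵥ ψ = (t : ℂ) := by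
    simp [dotProduct, ht, Complex.conj_mul']
  have ht0 : 0 < t := by
    obtain ⟨p, hp⟩ := Function.ne_iff.1 h0
    exact Finset.sum_pos' (fun _ _ => by positivity)
      ⟨p, Finset.mem_univ p, pow_pos (norm_pos_iff.2 hp) 2⟩
  have hs : ((√t : ℝ) : ℂ) ≠ 0 := by simpa using (Real.sqrt_pos.2 ht0).ne'
  have hψ : ψ = ((√t : ℝ) : ℂ) • (((√t : ℝ) : ℂ)⁻¹ • ψ) := by
    rw [smul_smul, mul_inv_cancel₀ hs, one_smul]
  rw [hψ, ketBra_smul]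
  refine PointedCone.smul_mem _ (by positivity) (PointedCone.subset_hull ⟨_, ?_, ?_, rfl⟩)
  · have hsq : ((√t : ℝ) : ℂ) * ((√t : ℝ) : ℂ) = t := by
      rw [← Complex.ofReal_mul, Real.mul_self_sqrt ht0.le]
    have ht' : (t : ℂ) ≠ 0 := by exact_mod_cast ht0.ne'
    simp only [IsPureState, star_smul, smul_dotProduct, dotProduct_smul, hdot, smul_eq_mul]
    rw [star_inv₀, RCLike.star_def, Complex.conj_ofReal, ← mul_assoc, ← mul_inv, hsq,
      inv_mul_cancel₀ ht']
  · rw [pureSchmidtNumber_eq_rank, coordMatrix_smul]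
    refine le_trans ?_ h
    rw [← Matrix.one_mul (coordMatrix ψ), ← Matrix.smul_mul, Matrix.one_mul]
    exact Matrix.rank_mul_le_right _ _

/-- Product basis vectors have Schmidt number one, which is why `1 ≤ k` is needed. -/
theorem diagonal_mem_schmidtCone {dA dB k : ℕ} (hk : 1 ≤ k) {w : Fin dA × Fin dB → ℝ}
    (hw : ∀ p, 0 ≤ w p) :
    (Matrix.diagonal fun p => (w p : ℂ)) ∈ schmidtCone dA dB k := by
  have hsum : (Matrix.diagonal fun p => (w p : ℂ)) =
      ∑ p, w p • ketBra (Pi.single p 1 : BipartiteVec dA dB) := by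
    ext p q
    simp only [Matrix.sum_apply, Matrix.smul_apply, ketBra, Matrix.vecMulVec_apply,
      Pi.star_apply, Pi.single_apply, Matrix.diagonal_apply, apply_ite star, star_one, star_zero]
    by_cases h : p = q
    · subst h; simp
    · have : ∀ x, ¬(q = x ∧ p = x) := fun x hx => h (hx.2.trans hx.1.symm)
      simp [h, ← ite_and, this]
  rw [hsum]
  refine Submodule.sum_mem _ fun p _ => PointedCone.smul_mem _ (hw p) (ketBra_mem_schmidtCone ?_)
  have : coordMatrix (Pi.single p 1 : BipartiteVec dA dB) =
      Matrix.vecMulVec (Pi.single p.1 1) (Pi.single p.2 1) := by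
    ext i j
    simp [coordMatrix, Matrix.vecMulVec_apply, Pi.single_apply, Prod.ext_iff, ite_and]
    split_ifs <;> rfl
  rw [this]
  exact (Matrix.rank_vecMulVec_le _ _).trans hk

theorem trace_eq_one_of_mem_convexHull {dA dB k : ℕ} {σ : BipartiteOp dA dB}
    (hσ : σ ∈ convexHull ℝ (pureSchmidtProjectors dA dB k)) : σ.trace = 1 := by
  refine (Matrix.traceLinearMap (Fin dA × Fin dB) ℝ ℂ).eq_of_mem_convexHull ?_ hσ
  rintro _ ⟨ψ, hψ, -, rfl⟩
  rw [Matrix.traceLinearMap_apply, trace_ketBra]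
  exact hψ

/-- A nonzero element of the cone is a positive multiple of a point of the hull, where the trace is
one; unit trace forces the factor to be one. Decompositions can thus be built without normalizing
their terms. -/
theorem mem_convexHull_of_mem_schmidtCone {dA dB k : ℕ} {ρ : BipartiteOp dA dB}
    (hρ : ρ ∈ schmidtCone dA dB k) (htr : ρ.trace = 1) :
    ρ ∈ convexHull ℝ (pureSchmidtProjectors dA dB k) := by
  set S := pureSchmidtProjectors dA dB k
  have key : ρ = 0 ∨ ∃ t : ℝ, 0 < t ∧ ∃ σ ∈ convexHull ℝ S, ρ = t • σ := by
    clear htr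
    induction hρ using Submodule.span_induction with
    | mem x hx => exact Or.inr ⟨1, one_pos, x, subset_convexHull ℝ S hx, (one_smul ℝ x).symm⟩
    | zero => exact Or.inl rfl
    | add x y _ _ hx hy =>
      rcases hx with rfl | ⟨s, hs, σ, hσ, rfl⟩
      · simpa using hy
      rcases hy with rfl | ⟨t, ht, τ, hτ, rfl⟩
      · exact Or.inr ⟨s, hs, σ, hσ, add_zero _⟩
      refine Or.inr ⟨s + t, by positivity, (s / (s + t)) • σ + (t / (s + t)) • τ,
        convex_convexHull ℝ S hσ hτ (by positivity) (by positivity) (by field_simp), ?_⟩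
      rw [smul_add, smul_smul, smul_smul, mul_div_cancel₀ _ (by positivity),
        mul_div_cancel₀ _ (by positivity)]
    | smul c x _ hx =>
      rcases hx with rfl | ⟨s, hs, σ, hσ, rfl⟩
      · exact Or.inl (smul_zero _)
      rcases eq_or_lt_of_le c.2 with hc | hc
      · left
        have : c = 0 := Subtype.ext hc.symm
        rw [this, zero_smul]
      · exact Or.inr ⟨c * s, mul_pos hc hs, σ, hσ, by rw [mul_smul]; rfl⟩
  rcases key with rfl | ⟨t, -, σ, hσ, rfl⟩
  · simp at htr
  · rw [Matrix.trace_smul, trace_eq_one_of_mem_convexHull hσ] at htr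
    have : t = 1 := by simpa using congrArg Complex.re htr
    rwa [this, one_smul]

/-! ### Embedding `ℂ^r ⊗ ℂ^r`, and the noisy state -/

/-- The isometric inclusion of `ℂ^r` into `ℂ^d` on the first `r` basis vectors. -/
def inclusionMatrix {r d : ℕ} (h : r ≤ d) : Matrix (Fin d) (Fin r) ℂ :=
  (1 : Matrix (Fin d) (Fin d) ℂ).submatrix id (Fin.castLE h)

theorem kronecker_inclusionMatrix_mulVec_rowVec {r dA dB : ℕ} (hA : r ≤ dA) (hB : r ≤ dB)
    (P : Matrix (Fin r) (Fin r) ℂ) :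
    (inclusionMatrix hA ⊗ₖ inclusionMatrix hB) *ᵥ Matrix.rowVec P =
      Matrix.rowVec (inclusionMatrix hA * P * (inclusionMatrix hB)ᵀ) := by
  ext ⟨i, j⟩
  simp only [Matrix.rowVec, Matrix.mulVec, dotProduct, Fintype.sum_prod_type,
    Matrix.kroneckerMap_apply, Matrix.mul_apply, Matrix.transpose_apply, Finset.sum_mul]
  rw [Finset.sum_comm]
  exact Finset.sum_congr rfl fun a _ => Finset.sum_congr rfl fun b _ => by ring

theorem inclusionMatrix_mul_transpose_apply {r dA dB : ℕ} (hA : r ≤ dA) (hB : r ≤ dB)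
    (i : Fin dA) (j : Fin dB) :
    (inclusionMatrix hA * (inclusionMatrix hB)ᵀ) i j =
      if (i : ℕ) = (j : ℕ) ∧ (i : ℕ) < r then 1 else 0 := by
  simp only [inclusionMatrix, Matrix.mul_apply, Matrix.submatrix_apply, Matrix.transpose_apply,
    id, Matrix.one_apply, Fin.ext_iff, Fin.val_castLE, mul_ite, mul_one, mul_zero]
  split_ifs with h
  · rw [Finset.sum_eq_single ⟨i, h.2⟩]
    · simp [h.1.symm]
    · intro b _ hb
      have : (i : ℕ) ≠ b := fun h' => hb (Fin.ext h'.symm)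
      simp [this]
    · simp
  · refine Finset.sum_eq_zero fun b _ => ?_
    split_ifs with h₁ h₂
    · exact absurd ⟨h₂.trans h₁.symm, h₂ ▸ b.2⟩ h
    · rfl
    · rfl

theorem inclusionMatrix_mul_conjTranspose {r d : ℕ} (h : r ≤ d) :
    inclusionMatrix h * (inclusionMatrix h)ᴴ =
      Matrix.diagonal fun i : Fin d => if (i : ℕ) < r then (1 : ℂ) else 0 := by
  have : (inclusionMatrix h)ᴴ = (inclusionMatrix h)ᵀ := by
    ext i j
    simp [inclusionMatrix, Matrix.one_apply, apply_ite]
  ext i j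
  rw [this, inclusionMatrix_mul_transpose_apply, Matrix.diagonal_apply]
  simp only [← Fin.ext_iff, ite_and]

theorem plusState_eq_smul {dA dB r : ℕ} (hA : r ≤ dA) (hB : r ≤ dB) :
    plusState dA dB r = ((1 / √(r : ℝ) : ℝ) : ℂ) •
      Matrix.rowVec (inclusionMatrix hA * (1 : Matrix (Fin r) (Fin r) ℂ) *
        (inclusionMatrix hB)ᵀ) := by
  ext ⟨i, j⟩
  rw [Matrix.mul_one]
  simp only [Matrix.rowVec, Pi.smul_apply, inclusionMatrix_mul_transpose_apply]
  simp [plusState]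

theorem ketBra_plusState {dA dB r : ℕ} (hA : r ≤ dA) (hB : r ≤ dB) :
    ketBra (plusState dA dB r) = (1 / r : ℝ) •
      Matrix.conjLinearMap (inclusionMatrix hA ⊗ₖ inclusionMatrix hB)
        (Matrix.maxEntangled (Fin r)) := by
  rw [plusState_eq_smul hA hB, ketBra_smul, Matrix.maxEntangled]
  congr 1
  · simp
  · rw [Matrix.conjLinearMap_apply, Matrix.conj_vecMulVec, kronecker_inclusionMatrix_mulVec_rowVec]
    rfl

theorem conjLinearMap_inclusionMatrix_one {dA dB r : ℕ} (hA : r ≤ dA) (hB : r ≤ dB) :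
    Matrix.conjLinearMap (inclusionMatrix hA ⊗ₖ inclusionMatrix hB) 1 =
      Matrix.diagonal fun p : Fin dA × Fin dB =>
        if (p.1 : ℕ) < r ∧ (p.2 : ℕ) < r then (1 : ℂ) else 0 := by
  rw [Matrix.conjLinearMap_apply, Matrix.mul_one, Matrix.conjTranspose_kronecker, ← Matrix.mul_kronecker_mul,
    inclusionMatrix_mul_conjTranspose, inclusionMatrix_mul_conjTranspose,
    Matrix.diagonal_kronecker_diagonal]
  congr 1
  ext p
  by_cases h₁ : (p.1 : ℕ) < r <;> by_cases h₂ : (p.2 : ℕ) < r <;> simp [h₁, h₂]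

theorem isPureState_plusState {dA dB r : ℕ} (hr : 1 ≤ r) (hA : r ≤ dA) (hB : r ≤ dB) :
    IsPureState (plusState dA dB r) := by
  have hr0 : (r : ℂ) ≠ 0 := by exact_mod_cast (show r ≠ 0 by omega)
  have horth : ∀ {d : ℕ} (h : r ≤ d), (inclusionMatrix h)ᴴ * inclusionMatrix h = 1 := by
    intro d h
    ext i j
    simp [inclusionMatrix, Matrix.mul_apply, Matrix.one_apply, apply_ite]
  have htr : (Matrix.maxEntangled (Fin r)).trace = r := by
    rw [Matrix.maxEntangled, Matrix.trace_vecMulVec_rowVec]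
    simp
  rw [IsPureState, ← trace_ketBra, ketBra_plusState hA hB, Matrix.trace_smul,
    Matrix.conjLinearMap_apply, Matrix.mul_assoc, Matrix.trace_mul_comm, Matrix.mul_assoc, Matrix.conjTranspose_kronecker,
    ← Matrix.mul_kronecker_mul, horth, horth, Matrix.one_kronecker_one, Matrix.mul_one, htr]
  simp [hr0]

theorem noisyPlusState_mem_densityOperators {dA dB r : ℕ} (hr : 1 ≤ r) (hA : r ≤ dA)
    (hB : r ≤ dB) {ε : ℝ} (hε₀ : 0 ≤ ε) (hε₁ : ε ≤ 1) :
    noisyPlusState dA dB r ε ∈ densityOperators dA dB := by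
  constructor
  · refine Matrix.PosSemidef.add ?_ ?_
    · exact (Matrix.posSemidef_vecMulVec_self_star _).smul (sub_nonneg.2 hε₁)
    · exact Matrix.PosSemidef.one.smul (by positivity)
  · have hA0 : (dA : ℂ) ≠ 0 := by exact_mod_cast (show dA ≠ 0 by omega)
    have hB0 : (dB : ℂ) ≠ 0 := by exact_mod_cast (show dB ≠ 0 by omega)
    rw [noisyPlusState, Matrix.trace_add, Matrix.trace_smul, Matrix.trace_smul, trace_ketBra,
      isPureState_plusState hr hA hB, Matrix.trace_one]
    simp only [Fintype.card_prod, Fintype.card_fin, Complex.real_smul]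
    push_cast
    field_simp
    ring

theorem smul_one_eq_diagonal {dA dB : ℕ} (v : ℝ) :
    v • (1 : BipartiteOp dA dB) = Matrix.diagonal fun _ => (v : ℂ) := by
  ext p q
  simp [Matrix.one_apply, Matrix.diagonal_apply]

theorem plusState_mem_schmidtCone {dA dB r : ℕ} (hA : r ≤ dA) (hB : r ≤ dB) :
    ketBra (plusState dA dB r) ∈ schmidtCone dA dB r := by
  apply ketBra_mem_schmidtCone
  rw [plusState_eq_smul hA hB, coordMatrix_smul, coordMatrix_rowVec, ← Matrix.mul_smul]
  exact (Matrix.rank_mul_le_left _ _).trans (Matrix.rank_le_width _)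

/-! ### Upper bound -/

/-- The embedded isotropic operators of overlap at most `k / r` have Schmidt number at most `k`. -/
theorem conj_isotropic_mem_schmidtCone {dA dB r k : ℕ} (hA : r ≤ dA) (hB : r ≤ dB) (hr : 2 ≤ r)
    (hk : k ≤ r) :
    Matrix.conjLinearMap (inclusionMatrix hA ⊗ₖ inclusionMatrix hB)
      ((k * (k * r - 1) / (r * (r ^ 2 - 1)) : ℝ) • Matrix.maxEntangled (Fin r) +
        (k * (r - k) / (r * (r ^ 2 - 1)) : ℝ) • 1) ∈ schmidtCone dA dB k := by
  have : Nontrivial (Fin r) := Fin.nontrivial_iff_two_le.2 hr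
  obtain ⟨s, -, hs⟩ := Finset.exists_subset_card_eq
    (show k ≤ (Finset.univ : Finset (Fin r)).card by simpa using hk)
  have hmem := Matrix.isotropic_mem_convexHull_conjOrbit s
  rw [hs, Fintype.card_fin] at hmem
  have := Set.mem_image_of_mem
    (Matrix.conjLinearMap (inclusionMatrix hA ⊗ₖ inclusionMatrix hB)) hmem
  rw [LinearMap.image_convexHull] at this
  refine convexHull_min ?_ (schmidtCone dA dB k).convex this
  rintro _ ⟨_, ⟨U, -, rfl⟩, rfl⟩
  rw [Matrix.conjLinearMap_apply, Matrix.conj_vecMulVec, kronecker_inclusionMatrix_mulVec_rowVec]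
  apply ketBra_mem_schmidtCone
  rw [coordMatrix_rowVec]
  refine (Matrix.rank_mul_le_left _ _).trans ((Matrix.rank_mul_le_right _ _).trans
    ((Matrix.rank_mul_le_left _ _).trans ((Matrix.rank_mul_le_right _ _).trans ?_)))
  rw [Matrix.rank_diagonal, ← hs]
  simp

theorem noisyPlusState_mem_schmidtClass {dA dB r k : ℕ} (hA : r ≤ dA) (hB : r ≤ dB)
    (hk : 1 ≤ k) (hkr : k ≤ r) {ε u : ℝ} (hε₀ : 0 ≤ ε) (hε₁ : ε < 1)
    (hu : u = ε / ((1 - ε) * (dA : ℝ) * (dB : ℝ)))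
    (hle : (1 + u) * (r : ℝ) / (1 + (r : ℝ) ^ 2 * u) ≤ k) :
    noisyPlusState dA dB r ε ∈ schmidtClass dA dB k := by
  have hρ := noisyPlusState_mem_densityOperators (hk.trans hkr) hA hB hε₀ hε₁.le
  refine ⟨hρ, mem_convexHull_of_mem_schmidtCone ?_ hρ.2⟩
  have hε : 0 < 1 - ε := sub_pos.2 hε₁
  have hA0 : (0 : ℝ) < dA := by exact_mod_cast (show 0 < dA by omega)
  have hB0 : (0 : ℝ) < dB := by exact_mod_cast (show 0 < dB by omega)
  have hu0 : 0 ≤ u := by rw [hu]; positivity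
  have hv : ε / ((dA : ℝ) * dB) = (1 - ε) * u := by rw [hu]; field_simp
  rw [noisyPlusState, hv]
  -- The case `k = r` needs no averaging. Removing it ensures `2 ≤ r` and `k * r - 1 > 0`.
  rcases hkr.eq_or_lt with rfl | hlt
  · refine add_mem (PointedCone.smul_mem _ hε.le (plusState_mem_schmidtCone hA hB)) ?_
    rw [smul_one_eq_diagonal]
    exact diagonal_mem_schmidtCone hk fun _ => by positivity
  have hk1 : (1 : ℝ) ≤ k := by exact_mod_cast hk
  have hkr' : (k : ℝ) + 1 ≤ r := by exact_mod_cast hlt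
  have hr1 : 0 < (r : ℝ) ^ 2 - 1 := by nlinarith
  have hr0 : (0 : ℝ) < r := by linarith
  have hkr1 : 0 < (k : ℝ) * r - 1 := by nlinarith
  have hne : (r : ℝ) * k - 1 ≠ 0 := by rw [mul_comm]; exact hkr1.ne'
  have hiso := conj_isotropic_mem_schmidtCone hA hB (show 2 ≤ r by omega) hkr
  set L := Matrix.conjLinearMap (inclusionMatrix hA ⊗ₖ inclusionMatrix hB)
  -- The weight of the identity on the `r × r` corner carried by the isotropic operator once its `Φ`
  -- coefficient is scaled to `(1 - ε)/r`. Then `c ≤ (1 - ε) * u` is exactly `hle` after clearing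
  -- denominators.
  set c : ℝ := (1 - ε) * (r - k) / (r * (k * r - 1)) with hc
  have hcu : c ≤ (1 - ε) * u := by
    rw [div_le_iff₀ (by positivity)] at hle
    rw [hc, mul_div_assoc]
    refine mul_le_mul_of_nonneg_left ?_ hε.le
    rw [div_le_iff₀ (by positivity)]
    nlinarith
  have hsplit : (1 - ε) • ketBra (plusState dA dB r) + ((1 - ε) * u) • (1 : BipartiteOp dA dB) =
      ((1 - ε) * (r ^ 2 - 1) / (k * (k * r - 1))) •
        L ((k * (k * r - 1) / (r * (r ^ 2 - 1)) : ℝ) • Matrix.maxEntangled (Fin r) +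
          (k * (r - k) / (r * (r ^ 2 - 1)) : ℝ) • 1) +
      Matrix.diagonal fun p => (((1 - ε) * u -
        c * (if (p.1 : ℕ) < r ∧ (p.2 : ℕ) < r then 1 else 0) : ℝ) : ℂ) := by
    have hdiag : (Matrix.diagonal fun p : Fin dA × Fin dB => (((1 - ε) * u -
        c * (if (p.1 : ℕ) < r ∧ (p.2 : ℕ) < r then 1 else 0) : ℝ) : ℂ)) =
        ((1 - ε) * u) • (1 : BipartiteOp dA dB) - c • L 1 := by
      rw [conjLinearMap_inclusionMatrix_one]
      ext p q
      by_cases h : p = q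
      · subst h
        simp [apply_ite (Complex.ofReal)]
      · simp [h]
    rw [hdiag, ketBra_plusState hA hB, map_add, map_smul, map_smul, smul_add, smul_smul, smul_smul,
      smul_smul,
      show (1 - ε) * (r ^ 2 - 1) / (k * (k * r - 1)) * (k * (k * r - 1) / (r * (r ^ 2 - 1))) =
        (1 - ε) * (1 / (r : ℝ)) by field_simp,
      show (1 - ε) * (r ^ 2 - 1) / (k * (k * r - 1)) * (k * (r - k) / (r * (r ^ 2 - 1))) = c by
        rw [hc]; field_simp]
    abel
  rw [hsplit]
  refine add_mem (PointedCone.smul_mem _ (by positivity) hiso) (diagonal_mem_schmidtCone hk ?_)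
  intro p
  split_ifs
  · linarith
  · rw [mul_zero, sub_zero]; positivity

/-! ### Lower bound -/

/-- The Schmidt-number witness obtained from `k ρ_A ⊗ I ≥ ρ`, evaluated on `|+_r⟩`. -/
def schmidtWitness {dA dB r : ℕ} (hA : r ≤ dA) (hB : r ≤ dB) (k : ℕ) :
    BipartiteOp dA dB →ₗ[ℝ] ℝ where
  toFun X := k * (∑ a : Fin r, ∑ j, (X (Fin.castLE hA a, j) (Fin.castLE hA a, j)).re) -
    ∑ a : Fin r, ∑ b : Fin r,
      (X (Fin.castLE hA a, Fin.castLE hB a) (Fin.castLE hA b, Fin.castLE hB b)).re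
  map_add' X Y := by simp [Finset.sum_add_distrib]; ring
  map_smul' c X := by simp [← Finset.mul_sum]; ring

theorem schmidtWitness_apply {dA dB r : ℕ} (hA : r ≤ dA) (hB : r ≤ dB) (k : ℕ)
    (X : BipartiteOp dA dB) : schmidtWitness hA hB k X =
    k * (∑ a : Fin r, ∑ j, (X (Fin.castLE hA a, j) (Fin.castLE hA a, j)).re) -
    ∑ a : Fin r, ∑ b : Fin r,
      (X (Fin.castLE hA a, Fin.castLE hB a) (Fin.castLE hA b, Fin.castLE hB b)).re := rfl

theorem schmidtWitness_ketBra_nonneg {dA dB r k : ℕ} (hA : r ≤ dA) (hB : r ≤ dB)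
    {ψ : BipartiteVec dA dB} (hψ : pureSchmidtNumber ψ ≤ k) :
    0 ≤ schmidtWitness hA hB k (ketBra ψ) := by
  let N : Matrix (Fin r) (Fin r) ℂ := (coordMatrix ψ).submatrix (Fin.castLE hA) (Fin.castLE hB)
  have hrank : N.rank ≤ k :=
    (Matrix.rank_submatrix_le _ _ _).trans ((pureSchmidtNumber_eq_rank ψ).symm.trans_le hψ)
  have hN := Matrix.norm_trace_sq_le_rank_mul N
  have htr : ∑ a : Fin r, ∑ b : Fin r, (ketBra ψ (Fin.castLE hA a, Fin.castLE hB a)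
      (Fin.castLE hA b, Fin.castLE hB b)).re = ‖N.trace‖ ^ 2 := by
    have h : ((‖N.trace‖ ^ 2 : ℝ) : ℂ) = ∑ a : Fin r, ∑ b : Fin r,
        ketBra ψ (Fin.castLE hA a, Fin.castLE hB a) (Fin.castLE hA b, Fin.castLE hB b) := by
      push_cast
      rw [← Complex.mul_conj']
      simp [Matrix.trace, N, coordMatrix, ketBra, Matrix.vecMulVec_apply, Finset.sum_mul_sum]
    have := congrArg Complex.re h
    rw [Complex.ofReal_re] at this
    simp only [this, Complex.re_sum]
  have hdiag : ∀ p, (ketBra ψ p p).re = ‖ψ p‖ ^ 2 := fun p => by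
    simp only [ketBra, Matrix.vecMulVec_apply, Pi.star_apply, RCLike.star_def, Complex.mul_conj']
    exact_mod_cast Complex.ofReal_re _
  -- Enlarging the corner to all `dB` columns is what puts `dB * r` in place of `r²` in the lower
  -- bound.
  have hsum : ∑ a, ∑ b, ‖N a b‖ ^ 2 ≤
      ∑ a : Fin r, ∑ j, (ketBra ψ (Fin.castLE hA a, j) (Fin.castLE hA a, j)).re := by
    refine Finset.sum_le_sum fun a _ => ?_
    simp only [hdiag]
    have := Finset.sum_le_sum_of_subset_of_nonneg
      (Finset.subset_univ (Finset.univ.map (Fin.castLEEmb hB)))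
      (f := fun j => ‖ψ (Fin.castLE hA a, j)‖ ^ 2) (fun _ _ _ => by positivity)
    rw [Finset.sum_map] at this
    exact this
  rw [schmidtWitness_apply, htr, sub_nonneg]
  refine hN.trans (mul_le_mul (by exact_mod_cast hrank) hsum ?_ (by positivity))
  exact Finset.sum_nonneg fun _ _ => Finset.sum_nonneg fun _ _ => by positivity

theorem schmidtWitness_noisyPlusState {dA dB r : ℕ} (hr : 1 ≤ r) (hA : r ≤ dA) (hB : r ≤ dB)
    (k : ℕ) (ε : ℝ) : schmidtWitness hA hB k (noisyPlusState dA dB r ε) =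
      k * ((1 - ε) + ε / ((dA : ℝ) * dB) * (r * dB)) -
        ((1 - ε) * r + ε / ((dA : ℝ) * dB) * r) := by
  have hr0 : (r : ℝ) ≠ 0 := by exact_mod_cast (show r ≠ 0 by omega)
  set v := ε / ((dA : ℝ) * dB) with hv
  have hentry : ∀ p q : Fin dA × Fin dB, (noisyPlusState dA dB r ε p q).re =
      (1 - ε) * ((if (p.1 : ℕ) = (p.2 : ℕ) ∧ (p.1 : ℕ) < r then 1 / √(r : ℝ) else 0) *
        (if (q.1 : ℕ) = (q.2 : ℕ) ∧ (q.1 : ℕ) < r then 1 / √(r : ℝ) else 0)) +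
      if p = q then v else 0 := by
    intro p q
    simp only [noisyPlusState, ketBra, plusState, Matrix.add_apply, Matrix.smul_apply,
      Matrix.vecMulVec_apply, Pi.star_apply, Complex.add_re, Complex.smul_re, Matrix.one_apply,
      smul_eq_mul, ← hv]
    congr 1
    · congr 1
      split_ifs <;> simp [-one_div]
    · split_ifs <;> simp
  have hsq : 1 / √(r : ℝ) * (1 / √(r : ℝ)) = 1 / r := by
    rw [div_mul_div_comm, Real.mul_self_sqrt (Nat.cast_nonneg r), one_mul]
  have h1 : ∀ a : Fin r, ∑ j : Fin dB,
      (noisyPlusState dA dB r ε (Fin.castLE hA a, j) (Fin.castLE hA a, j)).re =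
        (1 - ε) * (1 / r) + v * dB := by
    intro a
    simp only [hentry, if_true, Finset.sum_add_distrib]
    congr 1
    · rw [Finset.sum_eq_single (Fin.castLE hB a)]
      · simp only [Fin.val_castLE, a.2, and_self, if_true, hsq]
      · intro j _ hj
        have : ¬((a : ℕ) = j) := fun h => hj (Fin.ext h.symm)
        simp [this]
      · simp
    · simp [mul_comm]
  have h2 : ∀ a b : Fin r, (noisyPlusState dA dB r ε (Fin.castLE hA a, Fin.castLE hB a)
      (Fin.castLE hA b, Fin.castLE hB b)).re = (1 - ε) * (1 / r) + if a = b then v else 0 := by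
    intro a b
    simp only [hentry, Fin.val_castLE, a.2, b.2, and_self, if_true, hsq, Prod.mk.injEq,
      Fin.castLE_inj]
  rw [schmidtWitness_apply]
  simp only [h1, h2, Finset.sum_add_distrib, Finset.sum_const, Finset.card_univ, Fintype.card_fin,
    nsmul_eq_mul, Finset.sum_ite_eq, Finset.mem_univ, if_true]
  field_simp

theorem le_of_noisyPlusState_mem_schmidtClass {dA dB r k : ℕ} (hr : 1 ≤ r) (hA : r ≤ dA)
    (hB : r ≤ dB) {ε u : ℝ} (hε₀ : 0 ≤ ε) (hε₁ : ε < 1)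
    (hu : u = ε / ((1 - ε) * (dA : ℝ) * (dB : ℝ)))
    (h : noisyPlusState dA dB r ε ∈ schmidtClass dA dB k) :
    (1 + u) * (r : ℝ) / (1 + (dB : ℝ) * (r : ℝ) * u) ≤ k := by
  have hε : 0 < 1 - ε := sub_pos.2 hε₁
  have hA0 : (0 : ℝ) < dA := by exact_mod_cast (show 0 < dA by omega)
  have hB0 : (0 : ℝ) < dB := by exact_mod_cast (show 0 < dB by omega)
  have hu0 : 0 ≤ u := by rw [hu]; positivity
  have hv : ε / ((dA : ℝ) * dB) = (1 - ε) * u := by rw [hu]; field_simp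
  have hW : 0 ≤ schmidtWitness hA hB k (noisyPlusState dA dB r ε) := by
    refine convexHull_min (t := schmidtWitness hA hB k ⁻¹' Set.Ici 0) ?_
      ((convex_Ici 0).linear_preimage _) h.2
    rintro _ ⟨ψ, -, hψ, rfl⟩
    exact schmidtWitness_ketBra_nonneg hA hB hψ
  rw [schmidtWitness_noisyPlusState hr, hv] at hW
  rw [div_le_iff₀ (by positivity)]
  -- The witness value factors through `1 - ε > 0`, leaving the claimed inequality.
  have : 0 ≤ (1 - ε) * (k * (1 + dB * r * u) - (1 + u) * r) := by linarith
  linarith [nonneg_of_mul_nonneg_right this hε]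

/-! ### Conclusion -/

theorem mainTheorem9 (dA dB r : ℕ) (hd : dA ≤ dB) (hr : 1 ≤ r) (hrd : r ≤ dA)
    (ε : ℝ) (hε₀ : 0 ≤ ε) (hε₁ : ε < 1)
    (u : ℝ) (hu : u = ε / ((1 - ε) * (dA : ℝ) * (dB : ℝ))) :
    (⌈(1 + u) * (r : ℝ) / (1 + (dB : ℝ) * (r : ℝ) * u)⌉
        ≤ (schmidtNumber (noisyPlusState dA dB r ε) : ℤ) ∧
      (schmidtNumber (noisyPlusState dA dB r ε) : ℤ)
        ≤ ⌈(1 + u) * (r : ℝ) / (1 + (r : ℝ) ^ 2 * u)⌉) ∧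
    ((r : ℝ) ≤ √(dA : ℝ) → ε < 1 / 2 →
      schmidtNumber (noisyPlusState dA dB r ε) = r) := by
  have hrB := hrd.trans hd
  have hε : 0 < 1 - ε := sub_pos.2 hε₁
  have hA0 : (0 : ℝ) < dA := by exact_mod_cast (show 0 < dA by omega)
  have hB0 : (0 : ℝ) < dB := by exact_mod_cast (show 0 < dB by omega)
  have hr1 : (1 : ℝ) ≤ r := by exact_mod_cast hr
  have hu0 : 0 ≤ u := by rw [hu]; positivity
  set F := (1 + u) * (r : ℝ) / (1 + (r : ℝ) ^ 2 * u) with hF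
  have hFpos : 0 < F := by positivity
  have hFle : F ≤ r := by
    rw [hF, div_le_iff₀ (by positivity)]
    have : u ≤ (r : ℝ) ^ 2 * u := le_mul_of_one_le_left hu0 (one_le_pow₀ hr1)
    nlinarith
  -- Besides the upper bound, this shows that the set of admissible `k` is nonempty, so that its
  -- `sInf` is attained and not the default `0`.
  have hclass : noisyPlusState dA dB r ε ∈ schmidtClass dA dB ⌈F⌉₊ :=
    noisyPlusState_mem_schmidtClass hrd hrB (Nat.one_le_ceil_iff.2 hFpos) (Nat.ceil_le.2 hFle)
      hε₀ hε₁ hu (Nat.le_ceil F)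
  have hmem : noisyPlusState dA dB r ε ∈
      schmidtClass dA dB (schmidtNumber (noisyPlusState dA dB r ε)) :=
    Nat.sInf_mem (s := {k | noisyPlusState dA dB r ε ∈ schmidtClass dA dB k}) ⟨_, hclass⟩
  have hupper : schmidtNumber (noisyPlusState dA dB r ε) ≤ ⌈F⌉₊ := Nat.sInf_le hclass
  have hlower := le_of_noisyPlusState_mem_schmidtClass hr hrd hrB hε₀ hε₁ hu hmem
  refine ⟨⟨Int.ceil_le.2 (by exact_mod_cast hlower), ?_⟩, fun hrs hε2 => ?_⟩
  · rw [← Int.natCast_ceil_eq_ceil hFpos.le]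
    exact_mod_cast hupper
  · refine le_antisymm (hupper.trans (Nat.ceil_le.2 hFle)) ?_
    have hrA : (r : ℝ) ^ 2 ≤ dA := (Real.le_sqrt' (by linarith)).1 hrs
    have hudd : dA * (dB * u) < 1 := by
      rw [hu, show (dA : ℝ) * (dB * (ε / ((1 - ε) * dA * dB))) = ε / (1 - ε) by field_simp,
        div_lt_one hε]
      linarith
    have hdu : 0 ≤ dB * u := by positivity
    -- After clearing denominators, `r² dB u ≤ dA dB u = ε/(1 - ε) < 1` suffices; this is where `r²
    -- ≤ dA` and `ε < 1/2` enter.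
    have hlt : (r : ℝ) - 1 < schmidtNumber (noisyPlusState dA dB r ε) := by
      refine lt_of_lt_of_le ?_ hlower
      rw [lt_div_iff₀ (by positivity)]
      have h1 : (r : ℝ) ^ 2 * (dB * u) ≤ dA * (dB * u) := mul_le_mul_of_nonneg_right hrA hdu
      have h2 : 0 ≤ (r : ℝ) * (dB * u) := by positivity
      have h3 : 0 ≤ u * r := by positivity
      nlinarith
    have : (r : ℝ) < schmidtNumber (noisyPlusState dA dB r ε) + 1 := by linarith
    exact Nat.lt_succ_iff.1 (by exact_mod_cast this)
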